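/- Let $G$ be a finite simple graph with vertex set $V$ and degree sequence $d=(\deg_G(v))_{v\in V}$. The neighborhood degree list (NDL) of a graph $H$ on $V$ assigns to each vertex $v$ the list (with multiplicity, order irrelevant) of the degrees in $H$ of the neighbors of $v$ in $H$. A realization of the NDL of $G$ is a simple graph $H$ on the labeled vertex set $V$ such that, for every $v\in V$, the list of $v$ in $H$ equals the list of $v$ in $G$; realizations with different edge sets are considered different. For $k$ appearing in $d$, let $V_k$ be the set of vertices of degree $k$ in $G$, and for $v \in V$ let $\mu_v^{\ell}$ be the number of times $\ell$ appears in the list of $v$ in the NDL of $G$. Let $D^k$ be the list of the numbers $\mu_v^k$, $v\in V_k$. For distinct $k,\ell$ appearing in $d$, let $D^{k,\ell}_X$ be the list of the numbers $\mu_v^{\ell}$, $v\in V_k$, and $D^{k,\ell}_Y$ the list of the numbers $\mu_v^{k}$, $v\in V_\ell$. For a list $\pi$ of nonnegative integers in descending order, consider its Young diagram. Let $\alpha(\pi)$ be the partition whose parts are the lengths of the nonempty rows of the shape formed by the boxes on or to the right of the main diagonal (column index at least the row index), and let $\beta(\pi)$ be the partition whose parts are the lengths of the nonempty columns of the shape formed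 by the boxes strictly below the main diagonal. The conjugate $\pi^*$ of $\pi$ is given by $\pi^*_i=|\{j:\pi_j\ge i\}|$ for $1\le i\le \max_j \pi_j$. Then $G$ is the unique realization of its neighborhood degree list if and only if both of the following hold: 1. $\alpha(D^k)=\beta(D^k)$ for every $k$ appearing in $d$; 2. $D^{k,\ell}_X=(D^{k,\ell}_Y)^*$ for all distinct $k,\ell$ appearing in $d$, where the two sides are compared as partitions, that is, up to the order of their terms and disregarding terms equal to $0$. -/

import Mathlib

namespace NDL

section Tableaux

/-! A labelled tableau on a vertex set `V` assigns to each vertex `v` its component list, recorded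
as a multiset because the order of the terms inside a component list is irrelevant. -/

variable {V : Type*} [Fintype V]

open Classical in
/-- The neighborhood degree list of `G`: the component list at `v` consists of the degrees in `G`
of the neighbors of `v`, with multiplicity. -/
noncomputable def ndl (G : SimpleGraph V) (v : V) : Multiset ℕ :=
  (G.neighborFinset v).val.map fun w => G.degree w

/-- `H` is a (labelled) realization of the tableau `T`: every vertex has the prescribed
component list. -/
def IsRealization (T : V → Multiset ℕ) (H : SimpleGraph V) : Prop :=
  ∀ v, ndl H v = T v

/-- `G` is a realization of `T`, and no graph on `V` with a different edge set is one. -/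
def IsUniqueRealization (T : V → Multiset ℕ) (G : SimpleGraph V) : Prop :=
  IsRealization T G ∧ ∀ H : SimpleGraph V, IsRealization T H → H = G

/-- The list `d` of the lengths of the component lists. -/
def lengths (T : V → Multiset ℕ) : Multiset ℕ :=
  Finset.univ.val.map fun v => (T v).card

/-- The vertices whose component list has length `k`. -/
def lengthClass (T : V → Multiset ℕ) (k : ℕ) : Finset V :=
  Finset.univ.filter fun v => (T v).card = k

/-- `mult T ℓ v` is the number of times the term `ℓ` appears in the component list of `v`. -/
def mult (T : V → Multiset ℕ) (ℓ : ℕ) (v : V) : ℕ :=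
  (T v).count ℓ

/-- The list `D^k`. -/
def diagList (T : V → Multiset ℕ) (k : ℕ) : Multiset ℕ :=
  (lengthClass T k).val.map (mult T k)

/-- The first part of the bipartitioned list `D^{k,ℓ}`: the number of terms `ℓ` in each
component list of length `k`. -/
def bipListX (T : V → Multiset ℕ) (k ℓ : ℕ) : Multiset ℕ :=
  (lengthClass T k).val.map (mult T ℓ)

/-- The second part of the bipartitioned list `D^{k,ℓ}`: the number of terms `k` in each
component list of length `ℓ`. -/
def bipListY (T : V → Multiset ℕ) (k ℓ : ℕ) : Multiset ℕ :=
  (lengthClass T ℓ).val.map (mult T k)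

open Classical in
/-- The component lengths of the neighborhood degree list of `G` form the degree sequence
of `G`. -/
theorem lengths_ndl (G : SimpleGraph V) :
    lengths (ndl G) = Finset.univ.val.map fun v => G.degree v := by
  simp [lengths, ndl]

end Tableaux

section Partitions

/-- The positive terms of a list. A list of nonnegative integers, read as a partition, has these
as its parts. -/
def parts (s : Multiset ℕ) : Multiset ℕ :=
  s.filter fun a => 0 < a

/-- The conjugate of a list: its terms are the numbers of terms that are at least `i`, for
`i` from `1` up to the largest term. -/
def conjugate (s : Multiset ℕ) : Multiset ℕ :=
  (Finset.Icc 1 s.sup).val.map fun i => s.countP fun a => i ≤ a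

/-- The Young diagram whose row lengths are the terms of `s` in descending order. Boxes are pairs
(row index, column index), both counted from `0`. -/
def youngDiagram (s : Multiset ℕ) : YoungDiagram :=
  YoungDiagram.ofRowLens (s.sort (· ≥ ·)) (Multiset.pairwise_sort s (· ≥ ·)).sortedGE

/-- The boxes on or to the right of the main diagonal. -/
def upperShape (s : Multiset ℕ) : Finset (ℕ × ℕ) :=
  (youngDiagram s).cells.filter fun c => c.1 ≤ c.2

/-- The boxes strictly below the main diagonal. -/
def lowerShape (s : Multiset ℕ) : Finset (ℕ × ℕ) :=
  (youngDiagram s).cells.filter fun c => c.2 < c.1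

/-- The partition `α(s)`: the lengths of the nonempty rows of the upper shape. -/
def alpha (s : Multiset ℕ) : Multiset ℕ :=
  ((upperShape s).image Prod.fst).val.map fun i =>
    ((upperShape s).filter fun c => c.1 = i).card

/-- The partition `β(s)`: the lengths of the nonempty columns of the lower shape. -/
def beta (s : Multiset ℕ) : Multiset ℕ :=
  ((lowerShape s).image Prod.snd).val.map fun j =>
    ((lowerShape s).filter fun c => c.2 = j).card

end Partitions

end NDL

/-! A realization is a graph in which each vertex has prescribed numbers of neighbors in the degree
classes of `G`, so the problem splits into one graph on each class and one bipartite graph for each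
pair of classes. If `G` is unique, no edges `ua`, `vb` with `u`, `v` of equal degree and `a`, `b` of
equal degree can be switched to `ub`, `va`; hence neighborhoods within a class are nested
(`nested_of_isUniqueRealization`). Nesting makes each class a threshold graph and each pair a
bipartite graph with conjugate degree lists (`threshold_of_nested`, `conjugate_of_nested`).
Conversely, these extremal degree conditions leave no freedom: adjacency is given by a formula in
ranks and degrees (`adj_iff_of_threshold`, `rel_iff_of_conjugate`). Finally, `alpha_eq_beta_iff` and
`parts_eq_conjugate_iff` translate the conditions on partitions into these numerical ones. -/

namespace NDL

/-! ### Decreasing enumerations of the values of a function. -/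

section Rankings

open scoped Classical

variable {V : Type*}

/-- `r` numbers the elements of `S` from `0` in such a way that the values of `f` decrease, and
`F i` is the value at the element number `i` (and `0` if there is none). -/
structure IsRanking (S : Finset V) (f r : V → ℕ) (F : ℕ → ℕ) : Prop where
  injOn : Set.InjOn r S
  lt_card : ∀ v ∈ S, r v < S.card
  apply_rank : ∀ v ∈ S, F (r v) = f v
  antitone : Antitone F
  eq_zero : ∀ i, S.card ≤ i → F i = 0

theorem exists_isRanking (S : Finset V) (f : V → ℕ) : ∃ r F, IsRanking S f r F := by
  let e : S ≃ Fin S.card := S.equivFin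
  -- The dual order turns the ascending sort into a descending one.
  let g : Fin S.card → ℕᵒᵈ := fun i => OrderDual.toDual (f (e.symm i))
  let σ : Equiv.Perm (Fin S.card) := Tuple.sort g
  have hσ : Monotone (g ∘ σ) := Tuple.monotone_sort g
  refine ⟨fun v => if h : v ∈ S then σ.symm (e ⟨v, h⟩) else 0,
    fun i => if h : i < S.card then f (e.symm (σ ⟨i, h⟩)) else 0, ?_, ?_, ?_, ?_, ?_⟩
  · intro u hu v hv h
    have hu' : u ∈ S := hu
    have hv' : v ∈ S := hv
    simp only [hu', hv', dif_pos] at h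
    have h2 := e.injective (σ.symm.injective (Fin.ext h))
    exact congrArg Subtype.val h2
  · intro v hv
    simp only [hv, dif_pos]
    exact (σ.symm (e ⟨v, hv⟩)).2
  · intro v hv
    simp [hv]
  · intro i j hij
    by_cases hj : j < S.card
    · have hi : i < S.card := hij.trans_lt hj
      simp only [hi, hj, dif_pos]
      exact hσ (show (⟨i, hi⟩ : Fin S.card) ≤ ⟨j, hj⟩ from hij)
    · simp [hj]
  · intro i hi
    simp [hi]

namespace IsRanking

variable {S : Finset V} {f r : V → ℕ} {F : ℕ → ℕ}

theorem image_eq (hr : IsRanking S f r F) : S.image r = Finset.range S.card := by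
  apply Finset.eq_of_subset_of_card_le
  · intro i hi
    obtain ⟨v, hv, rfl⟩ := Finset.mem_image.1 hi
    exact Finset.mem_range.2 (hr.lt_card v hv)
  · rw [Finset.card_image_of_injOn hr.injOn, Finset.card_range]

theorem exists_rank_eq (hr : IsRanking S f r F) {i : ℕ} (hi : i < S.card) :
    ∃ v ∈ S, r v = i := by
  have h : i ∈ S.image r := by rw [hr.image_eq]; exact Finset.mem_range.2 hi
  exact Finset.mem_image.1 h

theorem exists_rank_eq_of_pos (hr : IsRanking S f r F) {i : ℕ} (hi : 0 < F i) :
    ∃ v ∈ S, r v = i := by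
  apply hr.exists_rank_eq
  by_contra h
  rw [hr.eq_zero i (not_lt.1 h)] at hi
  exact lt_irrefl _ hi

theorem card_filter_comp (hr : IsRanking S f r F) (p : ℕ → Prop) [DecidablePred p] :
    {v ∈ S | p (r v)}.card = {i ∈ Finset.range S.card | p i}.card := by
  rw [← hr.image_eq, Finset.filter_image, Finset.card_image_of_injOn]
  exact hr.injOn.mono fun v hv => (Finset.mem_filter.1 hv).1

theorem card_rank_lt (hr : IsRanking S f r F) {t : ℕ} (ht : t ≤ S.card) :
    {v ∈ S | r v < t}.card = t := by
  rw [hr.card_filter_comp fun i => i < t]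
  have : {i ∈ Finset.range S.card | i < t} = Finset.range t := by
    ext i; simp only [Finset.mem_filter, Finset.mem_range]; omega
  rw [this, Finset.card_range]

theorem map_eq (hr : IsRanking S f r F) :
    S.val.map f = (Finset.range S.card).val.map F := by
  rw [← hr.image_eq, Finset.image_val_of_injOn hr.injOn, Multiset.map_map]
  exact Multiset.map_congr rfl fun v hv => (hr.apply_rank v hv).symm

theorem card_filter_lt (hr : IsRanking S f r F) (i : ℕ) :
    {v ∈ S | i < f v}.card = {j ∈ Finset.range S.card | i < F j}.card := by
  rw [← hr.card_filter_comp fun j => i < F j]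
  congr 1
  exact Finset.filter_congr fun v hv => by rw [hr.apply_rank v hv]

end IsRanking

/-! ### Bipartite case: conjugate degree lists and nested rows. -/

section Relations

variable {S T : Finset V} {x y r : V → ℕ} {F : ℕ → ℕ} {R : V → V → Prop}

/-- A relation whose row sums are conjugate to its column sums is determined by them. -/
theorem rel_iff_of_conjugate (hr : IsRanking S x r F)
    (hx : ∀ a ∈ S, {b ∈ T | R a b}.card = x a) (hy : ∀ b ∈ T, {a ∈ S | R a b}.card = y b)
    (h : ∀ i, F i = {b ∈ T | i < y b}.card) :
    ∀ a ∈ S, ∀ b ∈ T, (R a b ↔ r a < y b) := by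
  suffices H : ∀ i, ∀ a ∈ S, r a = i → ∀ b ∈ T, (R a b ↔ r a < y b) from
    fun a ha => H _ a ha rfl
  intro i
  induction i using Nat.strong_induction_on with
  | _ i ih =>
    rintro a ha rfl
    have hsub : {b ∈ T | R a b} ⊆ {b ∈ T | r a < y b} := by
      intro b hb
      obtain ⟨hb, hab⟩ := Finset.mem_filter.1 hb
      refine Finset.mem_filter.2 ⟨hb, ?_⟩
      by_contra hlt
      have hle : y b ≤ r a := not_lt.1 hlt
      -- By induction column `b` already contains all `y b` rows of rank below `y b`; row `a` would
      -- be one too many.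
      have hs : insert a {c ∈ S | r c < y b} ⊆ {c ∈ S | R c b} := by
        intro c hc
        rcases Finset.mem_insert.1 hc with rfl | hc
        · exact Finset.mem_filter.2 ⟨ha, hab⟩
        · obtain ⟨hc, hcb⟩ := Finset.mem_filter.1 hc
          exact Finset.mem_filter.2 ⟨hc, (ih _ (hcb.trans_le hle) c hc rfl b hb).2 hcb⟩
      have hcard := Finset.card_le_card hs
      rw [Finset.card_insert_of_notMem (by simp [hlt]),
        hr.card_rank_lt (hle.trans (hr.lt_card a ha).le), hy b hb] at hcard
      omega
    have heq := Finset.eq_of_subset_of_card_le hsub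
      (by rw [hx a ha, ← h, hr.apply_rank a ha])
    intro b hb
    have := Finset.ext_iff.1 heq b
    simpa [hb] using this

/-- If the rows of a relation are nested then the row sums are conjugate to the column sums. -/
theorem conjugate_of_nested (hr : IsRanking S x r F)
    (hx : ∀ a ∈ S, {b ∈ T | R a b}.card = x a) (hy : ∀ b ∈ T, {a ∈ S | R a b}.card = y b)
    (hnest : ∀ a ∈ S, ∀ a' ∈ S, x a' ≤ x a → ∀ b ∈ T, R a' b → R a b) (i : ℕ) :
    F i = {b ∈ T | i < y b}.card := by
  have hnest' : ∀ a ∈ S, ∀ a' ∈ S, r a ≤ r a' → ∀ b ∈ T, R a' b → R a b := by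
    intro a ha a' ha' h
    apply hnest a ha a' ha'
    rw [← hr.apply_rank a ha, ← hr.apply_rank a' ha']
    exact hr.antitone h
  by_cases hi : i < S.card
  · obtain ⟨a, ha, rfl⟩ := hr.exists_rank_eq hi
    rw [hr.apply_rank a ha, ← hx a ha]
    congr 1
    refine Finset.filter_congr fun b hb => ?_
    rw [← hy b hb]
    constructor
    · intro hab
      -- By nesting, each column is an initial segment of the ranking.
      have hs : {c ∈ S | r c < r a + 1} ⊆ {c ∈ S | R c b} := by
        intro c hc
        obtain ⟨hc, hca⟩ := Finset.mem_filter.1 hc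
        exact Finset.mem_filter.2 ⟨hc, hnest' c hc a ha (Nat.lt_succ_iff.1 hca) b hb hab⟩
      have hcard := Finset.card_le_card hs
      rw [hr.card_rank_lt hi] at hcard
      exact hcard
    · intro hlt
      by_contra hab
      have hs : {c ∈ S | R c b} ⊆ {c ∈ S | r c < r a} := by
        intro c hc
        obtain ⟨hc, hcb⟩ := Finset.mem_filter.1 hc
        refine Finset.mem_filter.2 ⟨hc, ?_⟩
        by_contra hca
        exact hab (hnest' a ha c hc (not_lt.1 hca) b hb hcb)
      have hcard := Finset.card_le_card hs
      rw [hr.card_rank_lt hi.le] at hcard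
      omega
  · rw [hr.eq_zero i (not_lt.1 hi), eq_comm, Finset.card_eq_zero, Finset.filter_eq_empty_iff]
    intro b hb
    have := Finset.card_filter_le S fun a => R a b
    rw [hy b hb] at this
    omega

end Relations

/-! ### Graphs on one class: the threshold condition. -/

section Graphs

variable {S : Finset V} {x r : V → ℕ} {F : ℕ → ℕ} {H : SimpleGraph V}

/-- Strong induction on the rank, along the diagonal of the diagram. A neighbor `w` of `v` with `x w
≤ r v` would have too many neighbors, so the neighbors of `v` lie in a set of the same size; the `+
1` in the hypothesis accounts for `v` itself. -/
theorem adj_iff_of_rank_lt (hr : IsRanking S x r F)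
    (hx : ∀ v ∈ S, {w ∈ S | H.Adj v w}.card = x v)
    (h : ∀ i, i < F i → {w ∈ S | i < x w}.card = F i + 1) :
    ∀ v ∈ S, r v < x v → ∀ w ∈ S, v ≠ w → (H.Adj v w ↔ r v < x w) := by
  suffices K : ∀ i, ∀ v ∈ S, r v = i → r v < x v → ∀ w ∈ S, v ≠ w → (H.Adj v w ↔ r v < x w) from
    fun v hv => K _ v hv rfl
  intro i
  induction i using Nat.strong_induction_on with
  | _ i ih =>
    rintro v hv rfl hvx
    have hFv := hr.apply_rank v hv
    have hsub : {w ∈ S | H.Adj v w} ⊆ {w ∈ S | r v < x w}.erase v := by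
      intro w hw
      obtain ⟨hw, hvw⟩ := Finset.mem_filter.1 hw
      refine Finset.mem_erase.2 ⟨hvw.ne', Finset.mem_filter.2 ⟨hw, ?_⟩⟩
      by_contra hlt
      have hle : x w ≤ r v := not_lt.1 hlt
      have hFw := hr.apply_rank w hw
      have hvw' : r v < r w := by
        by_contra hcon
        have := hr.antitone (not_lt.1 hcon)
        omega
      have hs : insert v {u ∈ S | r u < x w} ⊆ {u ∈ S | H.Adj w u} := by
        intro u hu
        rcases Finset.mem_insert.1 hu with rfl | hu
        · exact Finset.mem_filter.2 ⟨hv, hvw.symm⟩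
        · obtain ⟨hu, huw⟩ := Finset.mem_filter.1 hu
          refine Finset.mem_filter.2 ⟨hu, SimpleGraph.Adj.symm ?_⟩
          have huv : r u < r v := huw.trans_le hle
          have hFu := hr.apply_rank u hu
          have := hr.antitone huv.le
          refine (ih _ huv u hu rfl (by omega) w hw ?_).2 huw
          rintro rfl
          omega
      have hcard := Finset.card_le_card hs
      rw [Finset.card_insert_of_notMem (by simp [hlt]),
        hr.card_rank_lt (hle.trans (hr.lt_card v hv).le), hx w hw] at hcard
      omega
    have hmem : v ∈ {w ∈ S | r v < x w} := Finset.mem_filter.2 ⟨hv, hvx⟩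
    have heq := Finset.eq_of_subset_of_card_le hsub (by
      rw [Finset.card_erase_of_mem hmem, h _ (by omega), hx v hv, hFv]
      omega)
    intro w hw hvw
    have := Finset.ext_iff.1 heq w
    simpa [hw, hvw.symm] using this

/-- A graph whose degrees on `S` satisfy the threshold condition is determined on `S` by them. -/
theorem adj_iff_of_threshold (hr : IsRanking S x r F)
    (hx : ∀ v ∈ S, {w ∈ S | H.Adj v w}.card = x v)
    (h : ∀ i, i < F i → {w ∈ S | i < x w}.card = F i + 1) {v w : V} (hv : v ∈ S) (hw : w ∈ S) :
    H.Adj v w ↔ v ≠ w ∧ (r v < x v ∧ r v < x w ∨ r w < x w ∧ r w < x v) := by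
  have key := adj_iff_of_rank_lt hr hx h
  by_cases hvw : v = w
  · simp [hvw]
  by_cases hvx : r v < x v
  · rw [key v hv hvx w hw hvw]
    refine ⟨fun H => ⟨hvw, Or.inl ⟨hvx, H⟩⟩, ?_⟩
    rintro ⟨-, ⟨-, H⟩ | ⟨h1, h2⟩⟩
    · exact H
    · exact (key v hv hvx w hw hvw).1 ((key w hw h1 v hv (Ne.symm hvw)).2 h2).symm
  -- When `x v ≤ r v`, the `x v` vertices of rank below `x v` all satisfy `r u < x u`, hence are
  -- adjacent to `v` and exhaust its neighborhood.
  · have hlow : ∀ u ∈ S, r u < x v → r u < x u := by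
      intro u hu huv
      rw [← hr.apply_rank u hu]
      rw [← hr.apply_rank v hv] at huv hvx
      exact huv.trans_le (hr.antitone (by omega))
    have hs : {u ∈ S | r u < x v} ⊆ {u ∈ S | H.Adj v u} := by
      intro u hu
      obtain ⟨hu, huv⟩ := Finset.mem_filter.1 hu
      refine Finset.mem_filter.2 ⟨hu, SimpleGraph.Adj.symm ?_⟩
      refine (key u hu (hlow u hu huv) v hv ?_).2 huv
      rintro rfl
      exact hvx huv
    have heq := Finset.eq_of_subset_of_card_le hs (by
      rw [hx v hv, hr.card_rank_lt ((not_lt.1 hvx).trans (hr.lt_card v hv).le)])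
    have := Finset.ext_iff.1 heq w
    simp only [Finset.mem_filter, hw, true_and] at this
    rw [← this]
    exact ⟨fun H => ⟨hvw, Or.inr ⟨hlow w hw H, H⟩⟩, fun H => by tauto⟩

/-- Nested neighborhoods on `S` force the threshold condition. -/
theorem threshold_of_nested (hr : IsRanking S x r F)
    (hx : ∀ v ∈ S, {w ∈ S | H.Adj v w}.card = x v)
    (hnest : ∀ v ∈ S, ∀ u ∈ S, x u ≤ x v → ∀ w ∈ S, w ≠ v → H.Adj u w → H.Adj v w)
    (i : ℕ) (hi : i < F i) : {w ∈ S | i < x w}.card = F i + 1 := by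
  have hnest' : ∀ v ∈ S, ∀ u ∈ S, r v ≤ r u → ∀ w ∈ S, w ≠ v → H.Adj u w → H.Adj v w := by
    intro v hv u hu h
    apply hnest v hv u hu
    rw [← hr.apply_rank v hv, ← hr.apply_rank u hu]
    exact hr.antitone h
  obtain ⟨v, hv, rfl⟩ := hr.exists_rank_eq_of_pos (Nat.zero_lt_of_lt hi)
  rw [hr.apply_rank v hv] at hi ⊢
  have hlt := hr.lt_card v hv
  have hmem : v ∈ {w ∈ S | r v < x w} := Finset.mem_filter.2 ⟨hv, hi⟩
  rw [← Finset.card_erase_add_one hmem, ← hx v hv]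
  congr 2
  ext w
  simp only [Finset.mem_erase, Finset.mem_filter]
  constructor
  · rintro ⟨hwv, hw, hlt'⟩
    refine ⟨hw, ?_⟩
    by_contra hadj
    have hs : {u ∈ S | H.Adj w u} ⊆ {u ∈ S | r u < r v} := by
      intro u hu
      obtain ⟨hu, hwu⟩ := Finset.mem_filter.1 hu
      refine Finset.mem_filter.2 ⟨hu, ?_⟩
      by_contra huv
      exact hadj (hnest' v hv u hu (not_lt.1 huv) w hw hwv hwu.symm)
    have hcard := Finset.card_le_card hs
    rw [hr.card_rank_lt hlt.le, hx w hw] at hcard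
    omega
  · rintro ⟨hw, hvw⟩
    refine ⟨hvw.ne', hw, ?_⟩
    -- Nesting is used below for vertices other than `w`; if `w` ranks no later than `v`,
    -- monotonicity suffices.
    by_cases hwv : r w ≤ r v
    · have := hr.antitone hwv
      rw [hr.apply_rank v hv, hr.apply_rank w hw] at this
      omega
    · have hs : {u ∈ S | r u < r v + 1} ⊆ {u ∈ S | H.Adj w u} := by
        intro u hu
        obtain ⟨hu, huv⟩ := Finset.mem_filter.1 hu
        refine Finset.mem_filter.2 ⟨hu, SimpleGraph.Adj.symm ?_⟩
        refine hnest' u hu v hv (Nat.lt_succ_iff.1 huv) w hw ?_ hvw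
        rintro rfl
        omega
      have hcard := Finset.card_le_card hs
      rw [hr.card_rank_lt hlt, hx w hw] at hcard
      exact hcard

end Graphs

end Rankings

end NDL

namespace NDL

/-! ### Partitions as antitone sequences. -/

section PartitionLemmas

open scoped Classical

/-- A multiset has only one decreasing enumeration, so equal partitions can be compared term by
term. -/
theorem map_range_inj {F G : ℕ → ℕ} (hF : Antitone F) (hG : Antitone G) {m n : ℕ}
    (h : (Finset.range m).val.map F = (Finset.range n).val.map G) :
    m = n ∧ ∀ i < m, F i = G i := by
  have hmn : m = n := by simpa using congrArg Multiset.card h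
  subst hmn
  refine ⟨rfl, ?_⟩
  have hsort : ∀ K : ℕ → ℕ, Antitone K → ((List.range m).map K).Pairwise (· ≥ ·) := by
    intro K hK
    rw [List.pairwise_map]
    exact List.pairwise_lt_range.imp fun hab => hK hab.le
  have hperm : ((List.range m).map F).Perm ((List.range m).map G) := Multiset.coe_eq_coe.1 h
  have heq := List.Perm.eq_of_pairwise' (hsort F hF) (hsort G hG) hperm
  intro i hi
  exact List.map_inj_left.1 heq i (List.mem_range.2 hi)

theorem eq_range_card {A : Finset ℕ} (h : ∀ i ∈ A, ∀ j ≤ i, j ∈ A) :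
    A = Finset.range A.card := by
  apply Finset.eq_of_subset_of_card_le
  · intro i hi
    have hs : Finset.range (i + 1) ⊆ A := fun j hj =>
      h i hi j (Nat.lt_succ_iff.1 (Finset.mem_range.1 hj))
    have := Finset.card_le_card hs
    rw [Finset.card_range] at this
    exact Finset.mem_range.2 this
  · simp

theorem sort_map_range {F : ℕ → ℕ} (hF : Antitone F) (n : ℕ) :
    ((Finset.range n).val.map F).sort (· ≥ ·) = (List.range n).map F := by
  have hs : ((List.range n).map F).Pairwise (· ≥ ·) := by
    rw [List.pairwise_map]
    exact List.pairwise_lt_range.imp fun hab => hF hab.le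
  refine List.Perm.eq_of_pairwise' (Multiset.pairwise_sort _ _) hs ?_
  rw [← Multiset.coe_eq_coe, Multiset.sort_eq]
  rfl

variable {F : ℕ → ℕ} {n : ℕ}

theorem mem_youngDiagram_map_range (hF : Antitone F) (h0 : ∀ i, n ≤ i → F i = 0) (c : ℕ × ℕ) :
    c ∈ (youngDiagram ((Finset.range n).val.map F)).cells ↔ c.2 < F c.1 := by
  rw [YoungDiagram.mem_cells, youngDiagram, YoungDiagram.mem_ofRowLens]
  simp only [sort_map_range hF, List.length_map, List.length_range, List.getElem_map,
    List.getElem_range, exists_prop, and_iff_right_iff_imp]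
  intro h
  by_contra hn
  rw [h0 _ (not_lt.1 hn)] at h
  exact Nat.not_lt_zero _ h

/-- Row `i` of the upper shape occupies the columns from `i` to `F i - 1`; `m` is the length of the
diagonal. -/
theorem alpha_map_range (hF : Antitone F) (h0 : ∀ i, n ≤ i → F i = 0) :
    ∃ m, (∀ i, i < m ↔ i < F i) ∧
      alpha ((Finset.range n).val.map F) = (Finset.range m).val.map fun i => F i - i := by
  have hmem : ∀ c, c ∈ upperShape ((Finset.range n).val.map F) ↔ c.2 < F c.1 ∧ c.1 ≤ c.2 := by
    intro c
    rw [upperShape, Finset.mem_filter, mem_youngDiagram_map_range hF h0]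
  have himg : ∀ i, i ∈ (upperShape ((Finset.range n).val.map F)).image Prod.fst ↔ i < F i := by
    intro i
    simp only [Finset.mem_image, hmem, Prod.exists]
    constructor
    · rintro ⟨a, b, ⟨h1, h2⟩, rfl⟩
      exact h2.trans_lt h1
    · intro h
      exact ⟨i, i, ⟨h, le_rfl⟩, rfl⟩
  have hrange := eq_range_card
    (A := (upperShape ((Finset.range n).val.map F)).image Prod.fst) (by
      intro i hi j hj
      rw [himg] at hi ⊢
      exact (hj.trans_lt hi).trans_le (hF hj))
  refine ⟨_, fun i => Finset.mem_range.symm.trans ((Finset.ext_iff.1 hrange i).symm.trans (himg i)), ?_⟩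
  rw [alpha, ← hrange]
  refine Multiset.map_congr rfl fun i _ => ?_
  rw [← Nat.card_Ico i (F i)]
  refine Finset.card_nbij' Prod.snd (fun j => (i, j)) ?_ ?_ ?_ ?_
  · rintro ⟨a, b⟩ h
    simp only [SetLike.mem_coe, Finset.mem_filter, hmem] at h
    simp only [SetLike.mem_coe, Finset.mem_Ico]
    obtain ⟨⟨h1, h2⟩, rfl⟩ := h
    exact ⟨h2, h1⟩
  · intro j h
    simp only [SetLike.mem_coe, Finset.mem_Ico] at h
    simp only [SetLike.mem_coe, Finset.mem_filter, hmem]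
    exact ⟨⟨h.2, h.1⟩, trivial⟩
  · rintro ⟨a, b⟩ h
    simp only [SetLike.mem_coe, Finset.mem_filter, hmem] at h
    simp [h.2]
  · intro j _
    rfl

theorem card_lt_antitone (F : ℕ → ℕ) (n : ℕ) :
    Antitone fun j => {i ∈ Finset.range n | j < F i}.card := by
  intro a b hab
  refine Finset.card_le_card fun i hi => ?_
  simp only [Finset.mem_filter] at hi ⊢
  exact ⟨hi.1, hab.trans_lt hi.2⟩

theorem filter_lt_eq_range (hF : Antitone F) (j : ℕ) :
    {i ∈ Finset.range n | j < F i} = Finset.range {i ∈ Finset.range n | j < F i}.card := by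
  apply eq_range_card
  intro i hi k hk
  simp only [Finset.mem_filter, Finset.mem_range] at hi ⊢
  exact ⟨hk.trans_lt hi.1, hi.2.trans_le (hF hk)⟩

/-- Conjugation reflects the diagram: both sides say that the box `(i, j)` belongs to it. -/
theorem lt_card_iff (hF : Antitone F) (h0 : ∀ i, n ≤ i → F i = 0) (i j : ℕ) :
    i < {i ∈ Finset.range n | j < F i}.card ↔ j < F i := by
  rw [← Finset.mem_range, ← filter_lt_eq_range hF, Finset.mem_filter, Finset.mem_range,
    and_iff_right_iff_imp]
  intro h
  by_contra hn
  rw [h0 _ (not_lt.1 hn)] at h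
  exact Nat.not_lt_zero _ h

/-- Column `j` reaches below the diagonal exactly when it contains the box `(j + 1, j)`. -/
theorem beta_map_range (hF : Antitone F) (h0 : ∀ i, n ≤ i → F i = 0) :
    ∃ m, (∀ j, j < m ↔ j < F (j + 1)) ∧
      beta ((Finset.range n).val.map F) =
        (Finset.range m).val.map fun j => {i ∈ Finset.range n | j < F i}.card - (j + 1) := by
  have hmem : ∀ c, c ∈ lowerShape ((Finset.range n).val.map F) ↔ c.2 < F c.1 ∧ c.2 < c.1 := by
    intro c
    rw [lowerShape, Finset.mem_filter, mem_youngDiagram_map_range hF h0]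
  have himg : ∀ j, j ∈ (lowerShape ((Finset.range n).val.map F)).image Prod.snd ↔
      j < F (j + 1) := by
    intro j
    simp only [Finset.mem_image, hmem, Prod.exists]
    constructor
    · rintro ⟨a, b, ⟨h1, h2⟩, rfl⟩
      exact h1.trans_le (hF h2)
    · intro h
      exact ⟨j + 1, j, ⟨h, Nat.lt_succ_self j⟩, rfl⟩
  have hrange := eq_range_card
    (A := (lowerShape ((Finset.range n).val.map F)).image Prod.snd) (by
      intro i hi j hj
      rw [himg] at hi ⊢
      exact (hj.trans_lt hi).trans_le (hF (Nat.succ_le_succ hj)))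
  refine ⟨_, fun i => Finset.mem_range.symm.trans ((Finset.ext_iff.1 hrange i).symm.trans (himg i)), ?_⟩
  rw [beta, ← hrange]
  refine Multiset.map_congr rfl fun j _ => ?_
  rw [← Nat.card_Ico]
  have hlt := fun i => lt_card_iff hF h0 i j
  refine Finset.card_nbij' Prod.fst (fun i => (i, j)) ?_ ?_ ?_ ?_
  · rintro ⟨a, b⟩ h
    simp only [SetLike.mem_coe, Finset.mem_filter, hmem] at h
    simp only [SetLike.mem_coe, Finset.mem_Ico, hlt]
    obtain ⟨⟨h1, h2⟩, rfl⟩ := h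
    exact ⟨h2, h1⟩
  · intro i h
    simp only [SetLike.mem_coe, Finset.mem_Ico, hlt] at h
    simp only [SetLike.mem_coe, Finset.mem_filter, hmem]
    exact ⟨⟨h.2, h.1⟩, trivial⟩
  · rintro ⟨a, b⟩ h
    simp only [SetLike.mem_coe, Finset.mem_filter, hmem] at h
    simp [h.2]
  · intro i _
    rfl

/-- The partitions `α` and `β` of a list agree exactly when its terms up to the diagonal are one
less than the corresponding terms of the conjugate. -/
theorem alpha_eq_beta_iff (hF : Antitone F) (h0 : ∀ i, n ≤ i → F i = 0) :
    alpha ((Finset.range n).val.map F) = beta ((Finset.range n).val.map F) ↔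
      ∀ i, i < F i → {j ∈ Finset.range n | i < F j}.card = F i + 1 := by
  obtain ⟨m, hm, hα⟩ := alpha_map_range hF h0
  obtain ⟨m', hm', hβ⟩ := beta_map_range hF h0
  rw [hα, hβ]
  constructor
  · intro h
    obtain ⟨rfl, hval⟩ := map_range_inj
      (fun a b hab => tsub_le_tsub (hF hab) hab)
      (fun a b hab => tsub_le_tsub (card_lt_antitone F n hab) (Nat.succ_le_succ hab)) h
    intro i hi
    have h1 := hval i ((hm i).2 hi)
    beta_reduce at h1
    -- The box `(i + 1, i)` is present, so the truncated subtraction in `beta` is genuine.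
    have h2 := (lt_card_iff hF h0 (i + 1) i).2 ((hm' i).1 ((hm i).2 hi))
    omega
  · intro h
    have hmm : m = m' := by
      have : ∀ i, i < m ↔ i < m' := by
        intro i
        rw [hm, hm']
        constructor
        · intro hi
          rw [← lt_card_iff hF h0, h i hi]
          omega
        · intro hi
          exact hi.trans_le (hF (Nat.le_succ i))
      have h1 := this m
      have h2 := this m'
      omega
    subst hmm
    refine Multiset.map_congr rfl fun i hi => ?_
    rw [h i ((hm i).1 (Finset.mem_range.1 hi))]
    omega

theorem parts_map_range (hF : Antitone F) (h0 : ∀ i, n ≤ i → F i = 0) :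
    ∃ m, (∀ i, i < m ↔ 0 < F i) ∧
      parts ((Finset.range n).val.map F) = (Finset.range m).val.map F := by
  refine ⟨{i ∈ Finset.range n | 0 < F i}.card, fun i => lt_card_iff hF h0 i 0, ?_⟩
  rw [← filter_lt_eq_range hF, parts, Multiset.filter_map, Finset.filter_val]
  rfl

/-- Shifts the index to start at `0`, to match ranks. -/
theorem conjugate_eq_map_range (t : Multiset ℕ) :
    conjugate t = (Finset.range t.sup).val.map fun i => t.countP fun a => i < a := by
  have h : (Finset.Icc 1 t.sup) = (Finset.range t.sup).map ⟨Nat.succ, Nat.succ_injective⟩ := by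
    ext i
    simp only [Finset.mem_Icc, Finset.mem_map, Finset.mem_range, Function.Embedding.coeFn_mk]
    constructor
    · intro h
      exact ⟨i - 1, by omega, by omega⟩
    · rintro ⟨j, hj, rfl⟩
      omega
  rw [conjugate, h, Finset.map_val, Multiset.map_map]
  rfl

theorem lt_sup_iff (t : Multiset ℕ) (i : ℕ) : i < t.sup ↔ 0 < t.countP fun a => i < a := by
  rw [Multiset.countP_pos, ← not_iff_not]
  push Not
  rw [Multiset.sup_le]

theorem parts_eq_conjugate_iff (hF : Antitone F) (h0 : ∀ i, n ≤ i → F i = 0) (t : Multiset ℕ) :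
    parts ((Finset.range n).val.map F) = conjugate t ↔
      ∀ i, F i = t.countP fun a => i < a := by
  obtain ⟨m, hm, hp⟩ := parts_map_range hF h0
  have hs := lt_sup_iff t
  rw [hp, conjugate_eq_map_range]
  have hG : Antitone fun i => t.countP fun a => i < a := by
    intro a b hab
    simp only [Multiset.countP_eq_card_filter]
    exact Multiset.card_le_card (Multiset.monotone_filter_right t fun c hc => hab.trans_lt hc)
  constructor
  · intro h
    obtain ⟨rfl, hval⟩ := map_range_inj hF hG h
    intro i
    by_cases hi : i < t.sup
    · exact hval i hi
    · have h1 := hm i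
      have h2 := hs i
      omega
  · intro h
    have hmm : m = t.sup := by
      have : ∀ i, i < m ↔ i < t.sup := by
        intro i
        rw [hm, hs, h]
      have h1 := this m
      have h2 := this t.sup
      omega
    rw [hmm]
    exact Multiset.map_congr rfl fun i _ => h i

end PartitionLemmas

end NDL

namespace NDL

/-! ### Realizations and switches. -/

section Realizations

open scoped Classical

variable {V : Type*} [Fintype V]

theorem card_ndl (G : SimpleGraph V) (v : V) : (ndl G v).card = G.degree v := by
  simp [ndl]

theorem count_map_neighborFinset (H : SimpleGraph V) (T : V → Multiset ℕ) (v : V) (ℓ : ℕ) :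
    ((H.neighborFinset v).val.map fun w => (T w).card).count ℓ =
      {w ∈ lengthClass T ℓ | H.Adj v w}.card := by
  rw [Multiset.count_map, ← Finset.filter_val, ← Finset.card_def]
  congr 1
  ext w
  simp [lengthClass, eq_comm, and_comm]

theorem ndl_eq_map_card (G : SimpleGraph V) (v : V) :
    ndl G v = (G.neighborFinset v).val.map fun w => (ndl G w).card := by
  simp only [card_ndl]
  rfl

theorem card_filter_adj (G : SimpleGraph V) (v : V) (ℓ : ℕ) :
    {w ∈ lengthClass (ndl G) ℓ | G.Adj v w}.card = mult (ndl G) ℓ v := by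
  rw [← count_map_neighborFinset, ← ndl_eq_map_card]
  rfl

/-- The realizations of the neighborhood degree list of `G` are the graphs in which every vertex
has as many neighbors in each degree class of `G` as it has in `G`. -/
theorem isRealization_ndl_iff (G H : SimpleGraph V) :
    IsRealization (ndl G) H ↔
      ∀ v ℓ, {w ∈ lengthClass (ndl G) ℓ | H.Adj v w}.card = mult (ndl G) ℓ v := by
  constructor
  · intro h v ℓ
    rw [← count_map_neighborFinset, mult, ← h v, ndl_eq_map_card H v]
    congr 2
    ext w
    rw [h w]
  · intro h
    -- Taking cardinalities here shows that `H` has the degrees of `G`, so these lists are the lists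
    -- of `H`.
    have key : ∀ v, ((H.neighborFinset v).val.map fun w => (ndl G w).card) = ndl G v := by
      intro v
      ext ℓ
      rw [count_map_neighborFinset, h]
      rfl
    intro v
    rw [ndl_eq_map_card H v, ← key v]
    congr 1
    ext w
    rw [← key w, card_ndl, Multiset.card_map, ← Finset.card_def, SimpleGraph.card_neighborFinset_eq_degree]

/-- The graph obtained from `G` by replacing the edges `ua`, `vb` by `ub`, `va`. -/
def switch (G : SimpleGraph V) (u v a b : V) (hub : u ≠ b) (hva : v ≠ a) : SimpleGraph V where
  Adj x y := (G.Adj x y ∧ s(x, y) ≠ s(u, a) ∧ s(x, y) ≠ s(v, b)) ∨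
    s(x, y) = s(u, b) ∨ s(x, y) = s(v, a)
  symm := ⟨fun x y h => by rwa [G.adj_comm, Sym2.eq_swap]⟩
  loopless := ⟨fun x h => by
    simp only [SimpleGraph.irrefl, false_and, false_or, Sym2.eq_iff] at h
    grind⟩

/-- At each of its four vertices a switch transposes two vertices with lists of equal length, which
preserves every class. -/
theorem card_filter_adj_eq_of_perm {T : V → Multiset ℕ} {G H : SimpleGraph V} {x : V} {ℓ : ℕ}
    {y z : V} (hyz : (T y).card = (T z).card)
    (h : ∀ w, H.Adj x w ↔ G.Adj x (Equiv.swap y z w)) :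
    {w ∈ lengthClass T ℓ | H.Adj x w}.card = {w ∈ lengthClass T ℓ | G.Adj x w}.card := by
  refine Finset.card_equiv (Equiv.swap y z) fun w => ?_
  have hw : (T (Equiv.swap y z w)).card = (T w).card := by
    rw [Equiv.swap_apply_def]
    split_ifs with h1 h2
    · rw [h1, hyz]
    · rw [h2, hyz]
    · rfl
  simp [lengthClass, h, hw]

theorem isRealization_switch {G : SimpleGraph V} {u v a b : V}
    (huv : (ndl G u).card = (ndl G v).card) (hab : (ndl G a).card = (ndl G b).card)
    (hua : G.Adj u a) (hvb : G.Adj v b) (hub : ¬ G.Adj u b) (hva : ¬ G.Adj v a)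
    (hub' : u ≠ b) (hva' : v ≠ a) : IsRealization (ndl G) (switch G u v a b hub' hva') := by
  rw [isRealization_ndl_iff]
  intro x ℓ
  rw [← card_filter_adj]
  have huv' : u ≠ v := by rintro rfl; exact hva hua
  have hab' : a ≠ b := by rintro rfl; exact hub hua
  have hua' := hua.ne
  have hvb' := hvb.ne
  by_cases hx1 : x = u
  · subst hx1
    refine card_filter_adj_eq_of_perm hab fun w => ?_
    simp only [switch, Sym2.eq_iff, Equiv.swap_apply_def, ne_eq]
    grind
  by_cases hx2 : x = v
  · subst hx2
    refine card_filter_adj_eq_of_perm hab fun w => ?_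
    simp only [switch, Sym2.eq_iff, Equiv.swap_apply_def, ne_eq]
    grind
  have hau := hua.symm
  have hbv := hvb.symm
  rw [G.adj_comm] at hub hva
  by_cases hx3 : x = a
  · subst hx3
    refine card_filter_adj_eq_of_perm huv fun w => ?_
    simp only [switch, Sym2.eq_iff, Equiv.swap_apply_def, ne_eq]
    grind
  by_cases hx4 : x = b
  · subst hx4
    refine card_filter_adj_eq_of_perm huv fun w => ?_
    simp only [switch, Sym2.eq_iff, Equiv.swap_apply_def, ne_eq]
    grind
  congr 1
  refine Finset.filter_congr fun w _ => ?_
  simp only [switch, Sym2.eq_iff]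
  grind

/-- In a unique realization, neighborhoods of vertices of equal degree are nested within each
degree class. -/
theorem nested_of_isUniqueRealization {G : SimpleGraph V}
    (h : IsUniqueRealization (ndl G) G) {k ℓ : ℕ} :
    ∀ v ∈ lengthClass (ndl G) k, ∀ u ∈ lengthClass (ndl G) k,
      mult (ndl G) ℓ u ≤ mult (ndl G) ℓ v →
        ∀ w ∈ lengthClass (ndl G) ℓ, w ≠ v → G.Adj u w → G.Adj v w := by
  intro v hv u hu hle w hw hwv huw
  by_contra hvw
  have hv' : (ndl G v).card = k := (Finset.mem_filter.1 hv).2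
  have hu' : (ndl G u).card = k := (Finset.mem_filter.1 hu).2
  have hw' : (ndl G w).card = ℓ := (Finset.mem_filter.1 hw).2
  -- Since `v` has at least as many neighbors in the class as `u` but lacks `w`, it has one that `u`
  -- lacks; this `b` permits a switch.
  have hex : ∃ b ∈ lengthClass (ndl G) ℓ, G.Adj v b ∧ b ≠ u ∧ ¬ G.Adj u b := by
    by_contra hno
    push Not at hno
    have hcard : {b ∈ lengthClass (ndl G) ℓ | G.Adj v b}.card ≤
        ({b ∈ lengthClass (ndl G) ℓ | G.Adj u b}.erase w).card := by
      -- The swap handles `b = u`, possible when `k = ℓ`: it is sent to the neighbor `v` of `u`.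
      refine Finset.card_le_card_of_injOn (Equiv.swap u v) ?_ (Equiv.injective _).injOn
      intro b hb
      obtain ⟨hb, hvb⟩ := Finset.mem_filter.1 hb
      have hb' : (ndl G b).card = ℓ := (Finset.mem_filter.1 hb).2
      by_cases hbu : b = u
      · subst hbu
        rw [Equiv.swap_apply_left]
        refine Finset.mem_erase.2 ⟨hwv.symm, Finset.mem_filter.2 ⟨?_, hvb.symm⟩⟩
        exact Finset.mem_filter.2 ⟨Finset.mem_univ _, by omega⟩
      · rw [Equiv.swap_apply_of_ne_of_ne hbu hvb.ne']
        refine Finset.mem_erase.2 ⟨?_, Finset.mem_filter.2 ⟨hb, hno b hb hvb hbu⟩⟩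
        rintro rfl
        exact hvw hvb
    have hmem : w ∈ {b ∈ lengthClass (ndl G) ℓ | G.Adj u b} := Finset.mem_filter.2 ⟨hw, huw⟩
    have hpos := Finset.card_pos.2 ⟨w, hmem⟩
    rw [Finset.card_erase_of_mem hmem] at hcard
    rw [card_filter_adj] at hcard hpos
    rw [card_filter_adj] at hcard
    omega
  obtain ⟨b, hb, hvb, hbu, hub⟩ := hex
  have hb' : (ndl G b).card = ℓ := (Finset.mem_filter.1 hb).2
  have heq := h.2 _ (isRealization_switch (hu'.trans hv'.symm) (hw'.trans hb'.symm) huw hvb hub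
    hvw hbu.symm hwv.symm)
  have hadj : (switch G u v w b hbu.symm hwv.symm).Adj u b := Or.inr (Or.inl rfl)
  rw [heq] at hadj
  exact hub hadj

theorem alpha_diagList_eq_beta_iff {T : V → Multiset ℕ} {k : ℕ} {r : V → ℕ} {F : ℕ → ℕ}
    (hr : IsRanking (lengthClass T k) (mult T k) r F) :
    alpha (diagList T k) = beta (diagList T k) ↔
      ∀ i, i < F i → {w ∈ lengthClass T k | i < mult T k w}.card = F i + 1 := by
  rw [diagList, hr.map_eq, alpha_eq_beta_iff hr.antitone hr.eq_zero]
  simp only [hr.card_filter_lt]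

theorem parts_bipListX_eq_conjugate_iff {T : V → Multiset ℕ} {k ℓ : ℕ} {r : V → ℕ} {F : ℕ → ℕ}
    (hr : IsRanking (lengthClass T k) (mult T ℓ) r F) :
    parts (bipListX T k ℓ) = conjugate (bipListY T k ℓ) ↔
      ∀ i, F i = {w ∈ lengthClass T ℓ | i < mult T k w}.card := by
  rw [bipListX, hr.map_eq, parts_eq_conjugate_iff hr.antitone hr.eq_zero]
  simp only [bipListY, Multiset.countP_map]
  rfl

theorem mem_lengthClass_card (T : V → Multiset ℕ) (v : V) : v ∈ lengthClass T (T v).card :=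
  Finset.mem_filter.2 ⟨Finset.mem_univ _, rfl⟩

theorem card_mem_lengths (T : V → Multiset ℕ) (v : V) : (T v).card ∈ lengths T :=
  Multiset.mem_map.2 ⟨v, Finset.mem_univ v, rfl⟩

end Realizations

end NDL

/-! ### The characterization. -/

open scoped Classical in
theorem mainTheorem6 {V : Type*} [Fintype V] (G : SimpleGraph V) :
    NDL.IsUniqueRealization (NDL.ndl G) G ↔
      (∀ k ∈ NDL.lengths (NDL.ndl G),
        NDL.alpha (NDL.diagList (NDL.ndl G) k) = NDL.beta (NDL.diagList (NDL.ndl G) k)) ∧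
      (∀ k ∈ NDL.lengths (NDL.ndl G), ∀ ℓ ∈ NDL.lengths (NDL.ndl G), k ≠ ℓ →
        NDL.parts (NDL.bipListX (NDL.ndl G) k ℓ) =
          NDL.conjugate (NDL.bipListY (NDL.ndl G) k ℓ)) := by
  have hcol : ∀ (H : SimpleGraph V) (k : ℕ) (b : V),
      {a ∈ NDL.lengthClass (NDL.ndl G) k | H.Adj a b} =
        {a ∈ NDL.lengthClass (NDL.ndl G) k | H.Adj b a} := fun H k b =>
    Finset.filter_congr fun a _ => H.adj_comm a b
  constructor
  · intro h
    refine ⟨fun k _ => ?_, fun k _ ℓ _ hkl => ?_⟩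
    · obtain ⟨r, F, hr⟩ := NDL.exists_isRanking (NDL.lengthClass (NDL.ndl G) k)
        (NDL.mult (NDL.ndl G) k)
      rw [NDL.alpha_diagList_eq_beta_iff hr]
      exact NDL.threshold_of_nested hr (fun v _ => NDL.card_filter_adj G v k)
        (NDL.nested_of_isUniqueRealization h)
    · obtain ⟨r, F, hr⟩ := NDL.exists_isRanking (NDL.lengthClass (NDL.ndl G) k)
        (NDL.mult (NDL.ndl G) ℓ)
      rw [NDL.parts_bipListX_eq_conjugate_iff hr]
      refine NDL.conjugate_of_nested (R := G.Adj) hr (fun v _ => NDL.card_filter_adj G v ℓ)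
        (fun b _ => by rw [hcol, NDL.card_filter_adj G b k]) ?_
      intro a ha a' ha' hle b hb
      refine NDL.nested_of_isUniqueRealization h a ha a' ha' hle b hb ?_
      rintro rfl
      exact hkl ((Finset.mem_filter.1 ha).2.symm.trans (Finset.mem_filter.1 hb).2)
  · rintro ⟨h1, h2⟩
    refine ⟨fun _ => rfl, fun H hH => ?_⟩
    rw [NDL.isRealization_ndl_iff] at hH
    have hG := NDL.card_filter_adj G
    have hmem := NDL.mem_lengthClass_card (NDL.ndl G)
    have hlen := NDL.card_mem_lengths (NDL.ndl G)
    ext v w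
    obtain ⟨r, F, hr⟩ := NDL.exists_isRanking
      (NDL.lengthClass (NDL.ndl G) (NDL.ndl G v).card)
      (NDL.mult (NDL.ndl G) (NDL.ndl G w).card)
    -- The ranking depends only on the lists, so in either case one formula describes adjacency in
    -- both `H` and `G`.
    by_cases hvw : (NDL.ndl G v).card = (NDL.ndl G w).card
    · rw [← hvw] at hr
      have hT := (NDL.alpha_diagList_eq_beta_iff hr).1 (h1 _ (hlen v))
      have hw : w ∈ NDL.lengthClass (NDL.ndl G) (NDL.ndl G v).card := hvw ▸ hmem w
      rw [NDL.adj_iff_of_threshold hr (fun u _ => hH u _) hT (hmem v) hw,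
        NDL.adj_iff_of_threshold hr (fun u _ => hG u _) hT (hmem v) hw]
    · have hT := (NDL.parts_bipListX_eq_conjugate_iff hr).1 (h2 _ (hlen v) _ (hlen w) hvw)
      rw [NDL.rel_iff_of_conjugate hr (fun u _ => hH u _)
          (fun b _ => by rw [hcol, hH]) hT v (hmem v) w (hmem w),
        NDL.rel_iff_of_conjugate hr (fun u _ => hG u _)
          (fun b _ => by rw [hcol, hG]) hT v (hmem v) w (hmem w)]
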